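/- Let $X$ be a set and let $\mathsf a:(0,\infty)\times X\times X\to[0,\infty)$ be an action cost, i.e. for all $\tau,\tau_1,\tau_2>0$ and $u,v,w\in X$: $\mathsf a(\tau,u,v)=0\Leftrightarrow u=v$; $\mathsf a(\tau,u,v)=\mathsf a(\tau,v,u)$; and $\mathsf a(\tau_1+\tau_2,u,w)\le \mathsf a(\tau_1,u,v)+\mathsf a(\tau_2,v,w)$. Assume: (i) $(X,\mathsf a)$ is complete: every sequence $(x_n)$ such that for all $\tau,c>0$ one has $\mathsf a(\tau,x_m,x_n)<c$ for all large $m,n$ admits a point $u\in X$ such that for all $\tau,c>0$ one has $\mathsf a(\tau,u,x_n)<c$ for all large $n$. (ii) $(X,\mathsf a)$ has the approximate mid-point property: for all $\rho>0$, $u,v\in X$ and $\epsilon>0$ there is $w\in X$ with $\mathsf a(\rho/2,u,w)+\mathsf a(\rho/2,w,v)\le \mathsf a(\rho,u,v)+\epsilon$. (iii) $\mathsf a$ is uniformly superlinear: there are an action cost $\mathsf b$ on $X$, a convex function $\psi:[0,\infty)\to[0,\infty)$ with $\psi(r)/r\to\infty$ as $r\to\infty$, and a constant $\lambda\ge1$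 such that $\lambda^{-1}\tau\,\psi(\tau^{-1}\mathsf b(\tau,u,v))\le \mathsf a(\tau,u,v)\le\lambda\tau\,\psi(\tau^{-1}\mathsf b(\tau,u,v))$ for all $\tau>0$, $u,v\in X$. (iv) $X$ carries a topology $\sigma$ such that either $(X,\sigma)$ is sequentially compact and $\mathsf a(\tau,\cdot,\cdot)$ is $\sigma$-sequentially lower semicontinuous on $X\times X$ for every $\tau>0$, or $(X,\sigma)$ is compact and $\mathsf a(\tau,\cdot,\cdot)$ is lower semicontinuous on $X\times X$ (with the product topology of $\sigma$) for every $\tau>0$. A curve $u:[0,\tau]\to X$ is called $\mathsf a$-absolutely continuous, $u\in \mathrm{AC}_{\mathsf a}([0,\tau];X)$, if there is $g\in L^1(0,\tau)$ with $\mathsf a(t-s,u(s),u(t))\le\int_s^t g(r)\,dr$ for all $0\le s<t\le\tau$. Then for every $\tau>0$ and $u_0,u_1\in X$ the following hold. For every $\Theta\in \mathrm{AC}_{\mathsf a}([0,\tau];X)$ the action density $$\mathfrak a[\Theta'](t):=\lim_{\sigma\downarrow t}\frac{\mathsf a(\sigma-t,\Theta(t),\Theta(\sigma))}{\sigma-t}=\lim_{\sigma\uparrow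 t}\frac{\mathsf a(t-\sigma,\Theta(\sigma),\Theta(t))}{t-\sigma}$$ exists (both limits exist and are equal) for a.e. $t\in(0,\tau)$ and is integrable on $(0,\tau)$. There is a curve $\omega_{\mathrm{opt}}\in \mathrm{AC}_{\mathsf a}([0,\tau];X)$ with $\omega_{\mathrm{opt}}(0)=u_0$, $\omega_{\mathrm{opt}}(\tau)=u_1$ such that $$\mathsf a(\tau,u_0,u_1)=\int_0^\tau\mathfrak a[\omega_{\mathrm{opt}}'](t)\,dt=\min\Big\{\int_0^\tau\mathfrak a[\Theta'](t)\,dt:\ \Theta\in \mathrm{AC}_{\mathsf a}([0,\tau];X),\ \Theta(0)=u_0,\ \Theta(\tau)=u_1\Big\}.$$ -/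

import Mathlib

open Set Filter Topology MeasureTheory

namespace ActionSpace

variable {X : Type*}

/-- `a` is an action cost on `X`, that is, `a : (0, ∞) × X × X → [0, ∞)` with the laws below.
The cost is encoded as a total function of `τ : ℝ`; its values at `τ ≤ 0` are unconstrained, and
no definition below ever uses them. -/
structure IsActionCost (a : ℝ → X → X → ℝ) : Prop where
  nonneg : ∀ τ, 0 < τ → ∀ u v, 0 ≤ a τ u v
  eq_zero_iff : ∀ τ, 0 < τ → ∀ u v, a τ u v = 0 ↔ u = v
  symm : ∀ τ, 0 < τ → ∀ u v, a τ u v = a τ v u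
  concat : ∀ τ₁ τ₂, 0 < τ₁ → 0 < τ₂ → ∀ u v w,
    a (τ₁ + τ₂) u w ≤ a τ₁ u v + a τ₂ v w

/-- Cauchy sequences of the uniform structure with basic entourages
`{(u, v) | a τ u v < c}`, `τ, c > 0`. -/
def IsCauchySeq (a : ℝ → X → X → ℝ) (x : ℕ → X) : Prop :=
  ∀ τ, 0 < τ → ∀ c, 0 < c → ∃ N : ℕ, ∀ m, N ≤ m → ∀ n, N ≤ n → a τ (x m) (x n) < c

/-- Convergence in the topology with basic neighbourhoods `{v | a τ u v < c}`, `τ, c > 0`. -/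
def ConvergesTo (a : ℝ → X → X → ℝ) (x : ℕ → X) (u : X) : Prop :=
  ∀ τ, 0 < τ → ∀ c, 0 < c → ∃ N : ℕ, ∀ n, N ≤ n → a τ u (x n) < c

/-- The action space `(X, a)` is complete. -/
def IsCompleteCost (a : ℝ → X → X → ℝ) : Prop :=
  ∀ x : ℕ → X, IsCauchySeq a x → ∃ u, ConvergesTo a x u

/-- The approximate mid-point property. -/
def HasApproxMidpoints (a : ℝ → X → X → ℝ) : Prop :=
  ∀ ρ, 0 < ρ → ∀ u v, ∀ ε, 0 < ε → ∃ w, a (ρ / 2) u w + a (ρ / 2) w v ≤ a ρ u v + ε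

/-- Uniform superlinearity: up to a constant factor, `a τ u v` is `τ * ψ (b τ u v / τ)` for an
action cost `b` and a convex function `ψ : [0, ∞) → [0, ∞)` with `ψ r / r → ∞` as `r → ∞`. -/
def IsUniformlySuperlinear (a : ℝ → X → X → ℝ) : Prop :=
  ∃ (b : ℝ → X → X → ℝ) (ψ : ℝ → ℝ) (l : ℝ),
    IsActionCost b ∧
    ConvexOn ℝ (Ici 0) ψ ∧ (∀ r, 0 ≤ r → 0 ≤ ψ r) ∧
    Tendsto (fun r => ψ r / r) atTop atTop ∧
    1 ≤ l ∧
    ∀ τ, 0 < τ → ∀ u v,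
      l⁻¹ * (τ * ψ (τ⁻¹ * b τ u v)) ≤ a τ u v ∧ a τ u v ≤ l * (τ * ψ (τ⁻¹ * b τ u v))

/-- Sequential lower semicontinuity of `a τ` for every `τ > 0` with respect to a topology of `X`.
The lower limit is taken in `[-∞, ∞]`. -/
def IsSeqLowerSemicontinuous [TopologicalSpace X] (a : ℝ → X → X → ℝ) : Prop :=
  ∀ τ, 0 < τ → ∀ (x y : ℕ → X) (u v : X), Tendsto x atTop (𝓝 u) → Tendsto y atTop (𝓝 v) →
    ((a τ u v : ℝ) : EReal) ≤ liminf (fun n => ((a τ (x n) (y n) : ℝ) : EReal)) atTop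

/-- The curve `u : [α, β] → X` is `a`-absolutely continuous; only the values of `u` on `[α, β]`
matter. -/
def IsAC (a : ℝ → X → X → ℝ) (α β : ℝ) (u : ℝ → X) : Prop :=
  ∃ g : ℝ → ℝ, IntegrableOn g (Ioo α β) ∧
    ∀ s t, α ≤ s → s < t → t ≤ β → a (t - s) (u s) (u t) ≤ ∫ r in s..t, g r

/-- The action density of a curve at time `t`: the limit of `a (σ - t) (u t) (u σ) / (σ - t)` as
`σ ↓ t` (a junk value where the limit does not exist, see `HasActionDensity`). -/
noncomputable def actionDensity (a : ℝ → X → X → ℝ) (u : ℝ → X) (t : ℝ) : ℝ :=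
  limUnder (𝓝[>] t) (fun σ => a (σ - t) (u t) (u σ) / (σ - t))

/-- At almost every `t ∈ (α, β)` the right and the left limit of the difference quotients
exist, and both are equal to the action density. -/
def HasActionDensity (a : ℝ → X → X → ℝ) (α β : ℝ) (u : ℝ → X) : Prop :=
  ∀ᵐ t ∂(volume.restrict (Ioo α β)),
    Tendsto (fun σ => a (σ - t) (u t) (u σ) / (σ - t)) (𝓝[>] t) (𝓝 (actionDensity a u t)) ∧
    Tendsto (fun σ => a (t - σ) (u σ) (u t) / (t - σ)) (𝓝[<] t) (𝓝 (actionDensity a u t))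

end ActionSpace

/-! For a curve, `F s t = a (t - s) (u s) (u t)` is a nonnegative subadditive interval function. If
it has a majorant, its variation `V` is finite and is the least one. A fine partition makes the
defect `V - F` locally dominated by a monotone function of small total increment, hence almost
everywhere of small derivative; so the difference quotients of `F` converge to `V'` almost
everywhere. This is the action density (`IsMajorant.ae_tendsto`). Absolute continuity excludes a
singular part of `V`, so the density integrates to at least the cost of the end points, and to at
most the increment of any majorant (`IsAC.hasActionDensity`).

It remains to find a curve with a majorant of total increment `a τ u₀ u₁`. Compactness and
semicontinuity turn approximate mid-points into exact ones. Iterated insertion gives a dyadic net of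
unchanged total cost, whose accumulated cost becomes the majorant `m` of the limit curve by
completeness and semicontinuity (`exists_curve_isMajorant`).

This `m` may still have jumps or a Cantor part. Superlinearity removes the difficulty: `b ≤ M * h +
ε * a` for every `ε`, so the variation of the curve for `b` has no singular part, and Jensen's
inequality carries absolute continuity back to `a` (`IsUniformlySuperlinear.isAC`). -/

namespace ActionSpace

/-! ### Subadditive interval functions and their variation -/

/-- A nonnegative subadditive function of the subintervals of `[α, β]`. -/
structure IsSubadditiveOn (F : ℝ → ℝ → ℝ) (α β : ℝ) : Prop where
  nonneg : ∀ s t, α ≤ s → s < t → t ≤ β → 0 ≤ F s t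
  subadd : ∀ r s t, α ≤ r → r < s → s < t → t ≤ β → F r t ≤ F r s + F s t

/-- The increments of `M` dominate the interval function `F` on `[α, β]`. -/
def IsMajorant (F : ℝ → ℝ → ℝ) (α β : ℝ) (M : ℝ → ℝ) : Prop :=
  ∀ s t, α ≤ s → s < t → t ≤ β → F s t ≤ M t - M s

/-- `v` is the sum of `F` over some partition of `[α, t]`. -/
inductive Chain (F : ℝ → ℝ → ℝ) (α : ℝ) : ℝ → ℝ → Prop
  | base : Chain F α α 0
  | step {s t v : ℝ} : Chain F α s v → s < t → Chain F α t (v + F s t)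

/-- The variation of `F` over `[α, t]`: the supremum of its sums over partitions. -/
noncomputable def intervalVariation (F : ℝ → ℝ → ℝ) (α t : ℝ) : ℝ := sSup {v | Chain F α t v}

variable {F : ℝ → ℝ → ℝ} {α β : ℝ} {M V : ℝ → ℝ}

theorem IsMajorant.monotoneOn (hM : IsMajorant F α β M) (hF : IsSubadditiveOn F α β) :
    MonotoneOn M (Icc α β) := by
  intro s hs t ht hst
  rcases hst.eq_or_lt with rfl | hst
  · exact le_rfl
  · linarith [hM s t hs.1 hst ht.2, hF.nonneg s t hs.1 hst ht.2]

theorem Chain.left_le {t v : ℝ} (h : Chain F α t v) : α ≤ t := by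
  induction h with
  | base => exact le_rfl
  | step _ hst ih => linarith

/-- The induction behind every upper bound of partition sums. `Φ` is arbitrary so that functions
glued from two formulas can be used. -/
theorem Chain.le_of_step {t v : ℝ} (h : Chain F α t v) {Φ : ℝ → ℝ} (h0 : 0 ≤ Φ α)
    (hΦ : ∀ s t, α ≤ s → s < t → t ≤ β → Φ s + F s t ≤ Φ t) (ht : t ≤ β) : v ≤ Φ t := by
  induction h with
  | base => exact h0
  | step hs hst ih => linarith [ih (by linarith), hΦ _ _ hs.left_le hst ht]

theorem Chain.exists_sum {t : ℝ} (ht : α ≤ t) : ∃ v, Chain F α t v := by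
  rcases ht.eq_or_lt with rfl | ht
  · exact ⟨0, .base⟩
  · exact ⟨_, .step .base ht⟩

theorem IsMajorant.bddAbove (hM : IsMajorant F α β M) {t : ℝ} (ht : t ≤ β) :
    BddAbove {v | Chain F α t v} := by
  refine ⟨M t - M α, fun v hv => ?_⟩
  exact Chain.le_of_step (Φ := fun t => M t - M α) hv (by simp)
    (fun s t h1 h2 h3 => by linarith [hM s t h1 h2 h3]) ht

/-- A partition of `[α, s]` extends by the one step from `s` to `t`; the given majorant only ensures
that the suprema are finite. -/
theorem IsMajorant.intervalVariation (hM : IsMajorant F α β M) :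
    IsMajorant F α β (intervalVariation F α) := by
  intro s t hs hst ht
  have : ActionSpace.intervalVariation F α s ≤ ActionSpace.intervalVariation F α t - F s t := by
    refine csSup_le (Chain.exists_sum hs) fun v hv => ?_
    have h : v + F s t ≤ ActionSpace.intervalVariation F α t :=
      le_csSup (hM.bddAbove ht) (Chain.step hv hst)
    linarith
  linarith

/-- Minimality of the variation: its increments lie below those of every majorant. -/
theorem IsMajorant.intervalVariation_sub_le (hM : IsMajorant F α β M)
    (hF : IsSubadditiveOn F α β) {s t : ℝ} (hs : α ≤ s) (hst : s < t) (ht : t ≤ β) :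
    ActionSpace.intervalVariation F α t - ActionSpace.intervalVariation F α s ≤ M t - M s := by
  set V := ActionSpace.intervalVariation F α with hV
  have hVm : IsMajorant F α β V := hM.intervalVariation
  have hVα : 0 ≤ V α := le_csSup (hM.bddAbove (by linarith)) Chain.base
  suffices h : V t ≤ if t ≤ s then V t else V s + (M t - M s) by
    rw [if_neg (not_le.2 hst)] at h
    linarith
  refine csSup_le (Chain.exists_sum (by linarith)) fun v hv => ?_
  -- The bound follows `V` up to `s` and the increments of `M` afterwards; a step that jumps over
  -- `s` is split there by subadditivity.
  refine Chain.le_of_step (Φ := fun y => if y ≤ s then V y else V s + (M y - M s)) (β := β) hv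
    ?_ ?_ ht
  · simpa [hs] using hVα
  · intro x y hx hxy hy
    rcases le_or_gt y s with h1 | h1
    · have h2 : x ≤ s := by linarith
      simp only [h1, h2, if_true]
      linarith [hVm x y hx hxy hy]
    · rcases lt_trichotomy x s with h2 | h2 | h2
      · simp only [h2.le, not_le.2 h1, if_true, if_false]
        linarith [hF.subadd x s y hx h2 h1 hy, hVm x s hx h2 (by linarith), hM s y hs h1 hy]
      · subst h2
        simp only [le_refl, not_le.2 h1, if_true, if_false]
        linarith [hM x y hx hxy hy]
      · simp only [not_le.2 h2, not_le.2 h1, if_false]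
        linarith [hM x y hx hxy hy]

/-- A partition sum `v` close to `V` yields a monotone function with small total increment that
locally dominates the defect `V y - V x - F x y`. -/
theorem Chain.exists_monotoneOn_defect {t v : ℝ} (h : Chain F α t v)
    (hF : IsSubadditiveOn F α β) (hV : IsMajorant F α β V) (ht : t ≤ β) :
    ∃ G : ℝ → ℝ, MonotoneOn G (Icc α t) ∧ G t - G α ≤ V t - V α - v ∧
      ∃ P : Set ℝ, P.Finite ∧ ∀ x ∈ Ioo α t, x ∉ P → ∀ᶠ y in 𝓝 x,
        (x < y → V y - V x - F x y ≤ G y - G x) ∧ (y < x → V x - V y - F y x ≤ G x - G y) := by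
  induction h with
  | base => exact ⟨0, by simp [MonotoneOn], by simp, ∅, finite_empty, by simp⟩
  | @step s t v hs hst ih =>
    obtain ⟨G, hG, hGt, P, hP, hGP⟩ := ih (by linarith)
    have hαs := hs.left_le
    -- Past `s` the new function adds the defect of `[s, y]`. By subadditivity its increment over
    -- `[x, y]` is at least `V y - V x - F x y ≥ 0`, which gives both monotonicity and domination.
    -- The point `s`, where the formulas meet, joins the exceptional set.
    let H : ℝ → ℝ := fun y => if y ≤ s then G y else G s + (V y - V s - F s y)
    have H1 : ∀ y, y ≤ s → H y = G y := fun y hy => if_pos hy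
    have H2 : ∀ y, s < y → H y = G s + (V y - V s - F s y) := fun y hy => if_neg (not_le.2 hy)
    refine ⟨H, ?_, ?_, insert s P, hP.insert s, ?_⟩
    · intro x hx y hy hxy
      rcases hxy.eq_or_lt with rfl | hxy
      · exact le_rfl
      rcases le_or_gt y s with h1 | h1
      · rw [H1 y h1, H1 x (by linarith)]
        exact hG ⟨hx.1, by linarith⟩ ⟨hy.1, h1⟩ hxy.le
      · have hyβ := hy.2.trans ht
        rw [H2 y h1]
        rcases le_or_gt x s with h2 | h2
        · rw [H1 x h2]
          linarith [hG ⟨hx.1, h2⟩ ⟨hαs, le_rfl⟩ h2, hV s y hαs h1 hyβ]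
        · rw [H2 x h2]
          linarith [hV x y hx.1 hxy hyβ, hF.subadd s x y hαs h2 hxy hyβ]
    · rw [H2 t hst, H1 α hαs]
      linarith
    · intro x hx hxP
      rw [mem_insert_iff, not_or] at hxP
      rcases lt_or_gt_of_ne hxP.1 with h1 | h1
      · filter_upwards [hGP x ⟨hx.1, h1⟩ hxP.2, Iio_mem_nhds h1] with y hy hys
        rw [H1 y (le_of_lt hys), H1 x h1.le]
        exact hy
      · filter_upwards [Ioi_mem_nhds h1, Iio_mem_nhds hx.2] with y (hys : s < y) (hyt : y < t)
        rw [H2 y hys, H2 x h1]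
        constructor
        · intro hxy
          linarith [hF.subadd s x y hαs h1 hxy (by linarith)]
        · intro hxy
          linarith [hF.subadd s y x hαs hys hxy (by linarith [hx.2])]

/-! ### Almost everywhere differentiation -/

theorem ae_hasDerivAt_of_monotoneOn {G : ℝ → ℝ} (hG : MonotoneOn G (Icc α β)) :
    ∀ᵐ x ∂volume.restrict (Ioo α β), HasDerivAt G (deriv G x) x := by
  rw [ae_restrict_iff' measurableSet_Ioo]
  filter_upwards [hG.ae_differentiableWithinAt_of_mem] with x hx hxm
  exact ((hx (Ioo_subset_Icc_self hxm)).differentiableAt (Icc_mem_nhds hxm.1 hxm.2)).hasDerivAt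

theorem deriv_nonneg_of_monotoneOn_Icc {G : ℝ → ℝ} (hG : MonotoneOn G (Icc α β)) {x : ℝ}
    (hx : x ∈ Ioo α β) : 0 ≤ deriv G x := by
  rw [← derivWithin_of_mem_nhds (Icc_mem_nhds hx.1 hx.2)]
  exact hG.derivWithin_nonneg

theorem integral_deriv_le_of_monotoneOn {G : ℝ → ℝ} (hαβ : α ≤ β) (hG : MonotoneOn G (Icc α β)) :
    IntervalIntegrable (deriv G) volume α β ∧ ∫ x in α..β, deriv G x ≤ G β - G α := by
  rw [← uIcc_of_le hαβ] at hG
  refine ⟨hG.intervalIntegrable_deriv, ?_⟩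
  have h := hG.intervalIntegral_deriv_mem_uIcc
  rw [uIcc_of_le] at h
  · exact h.2
  · linarith [hG left_mem_uIcc right_mem_uIcc hαβ]

theorem lintegral_deriv_le_of_monotoneOn {G : ℝ → ℝ} (hαβ : α ≤ β)
    (hG : MonotoneOn G (Icc α β)) :
    ∫⁻ x in Ioo α β, ENNReal.ofReal (deriv G x) ≤ ENNReal.ofReal (G β - G α) := by
  obtain ⟨h1, h2⟩ := integral_deriv_le_of_monotoneOn hαβ hG
  rw [intervalIntegral.integral_of_le hαβ, integral_Ioc_eq_integral_Ioo] at h2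
  rw [← ofReal_integral_eq_lintegral_ofReal]
  · exact ENNReal.ofReal_le_ofReal h2
  · exact (intervalIntegrable_iff_integrableOn_Ioo_of_le hαβ).1 h1
  · filter_upwards [ae_restrict_mem measurableSet_Ioo] with x hx
    exact deriv_nonneg_of_monotoneOn_Icc hG hx

/-- Monotone functions with arbitrarily small total increments have arbitrarily small
derivatives almost everywhere. -/
theorem ae_exists_deriv_lt {G : ℕ → ℝ → ℝ} (hαβ : α ≤ β)
    (hG : ∀ n, MonotoneOn (G n) (Icc α β)) (hsmall : ∀ n : ℕ, G n β - G n α ≤ 1 / ((n : ℝ) + 1)) :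
    ∀ᵐ x ∂volume.restrict (Ioo α β), ∀ ε > 0, ∃ n, deriv (G n) x < ε := by
  -- The integral of the infimum is at most that of each derivative, hence at most `1 / (n + 1)` for
  -- every `n`.
  have hz : ∫⁻ x in Ioo α β, ⨅ n, ENNReal.ofReal (deriv (G n) x) = 0 := by
    refine le_antisymm (ge_of_tendsto' (x := atTop)
      (f := fun n : ℕ => ENNReal.ofReal (1 / ((n : ℝ) + 1))) ?_ fun n => ?_) bot_le
    · simpa using ENNReal.tendsto_ofReal tendsto_one_div_add_atTop_nhds_zero_nat
    · calc _ ≤ ∫⁻ x in Ioo α β, ENNReal.ofReal (deriv (G n) x) := lintegral_mono fun x => iInf_le _ n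
        _ ≤ ENNReal.ofReal (G n β - G n α) := lintegral_deriv_le_of_monotoneOn hαβ (hG n)
        _ ≤ _ := ENNReal.ofReal_le_ofReal (hsmall n)
  rw [lintegral_eq_zero_iff (Measurable.iInf fun n => (measurable_deriv _).ennreal_ofReal)] at hz
  filter_upwards [hz] with x hx ε hε
  have hx' : ⨅ n, ENNReal.ofReal (deriv (G n) x) < ENNReal.ofReal ε := by
    rw [show (⨅ n, ENNReal.ofReal (deriv (G n) x)) = 0 from hx]
    exact ENNReal.ofReal_pos.2 hε
  obtain ⟨n, hn⟩ := iInf_lt_iff.1 hx'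
  exact ⟨n, (ENNReal.ofReal_lt_ofReal_iff hε).1 hn⟩

theorem tendsto_div_right_of_hasDerivAt {f : ℝ → ℝ} {f' x : ℝ} (h : HasDerivAt f f' x) :
    Tendsto (fun y => (f y - f x) / (y - x)) (𝓝[>] x) (𝓝 f') := by
  have := (hasDerivAt_iff_tendsto_slope.1 h).mono_left (nhdsGT_le_nhdsNE x)
  simpa [slope_fun_def_field] using this

theorem tendsto_div_left_of_hasDerivAt {f : ℝ → ℝ} {f' x : ℝ} (h : HasDerivAt f f' x) :
    Tendsto (fun y => (f x - f y) / (x - y)) (𝓝[<] x) (𝓝 f') := by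
  have := (hasDerivAt_iff_tendsto_slope.1 h).mono_left (nhdsLT_le_nhdsNE x)
  rw [slope_fun_def_field] at this
  refine this.congr fun y => ?_
  rw [← neg_sub (f x), ← neg_sub x, neg_div_neg_eq]

/-- The derivative of a subadditive interval function of bounded variation exists almost everywhere
and is the derivative of its variation. -/
theorem IsMajorant.ae_tendsto (hαβ : α ≤ β) (hF : IsSubadditiveOn F α β)
    (hM : IsMajorant F α β M) :
    ∀ᵐ x ∂volume.restrict (Ioo α β),
      Tendsto (fun y => F x y / (y - x)) (𝓝[>] x)
        (𝓝 (deriv (ActionSpace.intervalVariation F α) x)) ∧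
      Tendsto (fun y => F y x / (x - y)) (𝓝[<] x)
        (𝓝 (deriv (ActionSpace.intervalVariation F α) x)) := by
  set V := ActionSpace.intervalVariation F α with hVdef
  have hV : IsMajorant F α β V := hM.intervalVariation
  have hVα : 0 ≤ V α := le_csSup (hM.bddAbove hαβ) Chain.base
  have hex : ∀ n : ℕ, ∃ G : ℝ → ℝ, MonotoneOn G (Icc α β) ∧ G β - G α ≤ 1 / ((n : ℝ) + 1) ∧
      ∃ P : Set ℝ, P.Finite ∧ ∀ x ∈ Ioo α β, x ∉ P → ∀ᶠ y in 𝓝 x,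
        (x < y → V y - V x - F x y ≤ G y - G x) ∧
        (y < x → V x - V y - F y x ≤ G x - G y) := by
    intro n
    have hpos : 0 < 1 / ((n : ℝ) + 1) := by positivity
    obtain ⟨v, hv, hlt⟩ := exists_lt_of_lt_csSup (Chain.exists_sum (F := F) hαβ)
      (show V β - 1 / ((n : ℝ) + 1) < V β by linarith)
    obtain ⟨G, h1, h2, h3⟩ := Chain.exists_monotoneOn_defect hv hF hV le_rfl
    exact ⟨G, h1, by linarith, h3⟩
  choose G hG hsmall P hP hGP using hex
  have hPae : ∀ᵐ x ∂volume.restrict (Ioo α β), ∀ n, x ∉ P n := by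
    refine ae_all_iff.2 fun n => ae_restrict_of_ae ?_
    exact (hP n).measure_zero volume |> measure_eq_zero_iff_ae_notMem.1
  filter_upwards [ae_exists_deriv_lt hαβ hG hsmall, hPae,
    ae_all_iff.2 fun n => ae_hasDerivAt_of_monotoneOn (hG n),
    ae_hasDerivAt_of_monotoneOn (hV.monotoneOn hF), ae_restrict_mem measurableSet_Ioo]
    with x hlt hxP hGd hVd hx
  have key : ∀ ε > 0, ∃ n, deriv (G n) x < ε ∧ ∀ᶠ y in 𝓝 x,
        (x < y → V y - V x - F x y ≤ G n y - G n x) ∧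
        (y < x → V x - V y - F y x ≤ G n x - G n y) := by
    intro ε hε
    obtain ⟨n, hn⟩ := hlt ε hε
    exact ⟨n, hn, hGP n x hx (hxP n)⟩
  constructor
  -- The defect quotient is nonnegative, and eventually below the quotient of some `G n` whose
  -- derivative at `x` is less than `c`.
  · have hD : Tendsto (fun y => (V y - V x - F x y) / (y - x)) (𝓝[>] x) (𝓝 0) := by
      refine tendsto_order.2 ⟨fun c hc => ?_, fun c hc => ?_⟩
      · filter_upwards [self_mem_nhdsWithin, nhdsWithin_le_nhds (Iio_mem_nhds hx.2)]
          with y (hy : x < y) (hyβ : y < β)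
        refine hc.trans_le (div_nonneg ?_ (by linarith))
        linarith [hV x y hx.1.le hy hyβ.le]
      · obtain ⟨n, hn, hev⟩ := key c hc
        filter_upwards [self_mem_nhdsWithin, nhdsWithin_le_nhds hev,
          (tendsto_order.1 (tendsto_div_right_of_hasDerivAt (hGd n))).2 c hn] with y (hy : x < y) h1 h2
        refine lt_of_le_of_lt ?_ h2
        have := h1.1 hy
        gcongr
    have := (tendsto_div_right_of_hasDerivAt hVd).sub hD
    rw [sub_zero] at this
    refine this.congr fun y => ?_
    rw [← sub_div]; congr 1; ring
  · have hD : Tendsto (fun y => (V x - V y - F y x) / (x - y)) (𝓝[<] x) (𝓝 0) := by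
      refine tendsto_order.2 ⟨fun c hc => ?_, fun c hc => ?_⟩
      · filter_upwards [self_mem_nhdsWithin, nhdsWithin_le_nhds (Ioi_mem_nhds hx.1)]
          with y (hy : y < x) (hyα : α < y)
        refine hc.trans_le (div_nonneg ?_ (by linarith))
        linarith [hV y x hyα.le hy hx.2.le]
      · obtain ⟨n, hn, hev⟩ := key c hc
        filter_upwards [self_mem_nhdsWithin, nhdsWithin_le_nhds hev,
          (tendsto_order.1 (tendsto_div_left_of_hasDerivAt (hGd n))).2 c hn] with y (hy : y < x) h1 h2
        refine lt_of_le_of_lt ?_ h2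
        have := h1.2 hy
        gcongr
    have := (tendsto_div_left_of_hasDerivAt hVd).sub hD
    rw [sub_zero] at this
    refine this.congr fun y => ?_
    rw [← sub_div]; congr 1; ring


/-- Increment minus integral of the derivative is the singular mass of a monotone function. It is
additive and nonnegative, so that of `V` is at most that of `M` when `M - V` is monotone. -/
theorem sub_le_integral_deriv_add {α β : ℝ} {V M : ℝ → ℝ} (hαβ : α ≤ β)
    (hV : MonotoneOn V (Icc α β)) (hM : MonotoneOn M (Icc α β))
    (hVM : MonotoneOn (fun t => M t - V t) (Icc α β)) :
    V β - V α ≤ (∫ x in α..β, deriv V x) + ((M β - M α) - ∫ x in α..β, deriv M x) := by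
  have h1 := (integral_deriv_le_of_monotoneOn hαβ hVM).2
  have h2 : ∫ x in α..β, deriv (fun t => M t - V t) x =
      ∫ x in α..β, (deriv M x - deriv V x) := by
    rw [intervalIntegral.integral_of_le hαβ, intervalIntegral.integral_of_le hαβ,
      integral_Ioc_eq_integral_Ioo, integral_Ioc_eq_integral_Ioo]
    refine integral_congr_ae ?_
    filter_upwards [ae_hasDerivAt_of_monotoneOn hV, ae_hasDerivAt_of_monotoneOn hM] with x hx hy
    exact (hy.sub hx).deriv
  rw [h2, intervalIntegral.integral_sub (integral_deriv_le_of_monotoneOn hαβ hM).1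
    (integral_deriv_le_of_monotoneOn hαβ hV).1] at h1
  linarith

theorem integral_deriv_primitive {α β : ℝ} {g : ℝ → ℝ}
    (hg : IntervalIntegrable g volume α β) :
    ∫ x in α..β, deriv (fun t => ∫ r in α..t, g r) x = ∫ x in α..β, g x := by
  refine intervalIntegral.integral_congr_ae ?_
  filter_upwards [hg.ae_hasDerivAt_integral] with x hx hxm
  exact (hx (uIoc_subset_uIcc hxm) α left_mem_uIcc).deriv

/-! ### Action density of absolutely continuous curves -/

variable {X : Type*} {a : ℝ → X → X → ℝ} {u : ℝ → X} {α β : ℝ}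

theorem IsActionCost.isSubadditiveOn_curve (ha : IsActionCost a) (u : ℝ → X) (α β : ℝ) :
    IsSubadditiveOn (fun s t => a (t - s) (u s) (u t)) α β where
  nonneg s t _ hst _ := ha.nonneg _ (sub_pos.2 hst) _ _
  subadd r s t _ hrs hst _ := by
    have := ha.concat (s - r) (t - s) (sub_pos.2 hrs) (sub_pos.2 hst) (u r) (u s) (u t)
    rwa [show s - r + (t - s) = t - r by ring] at this

/-- The primitive of `g` is a majorant without singular mass, which is all that is used of absolute
continuity. -/
theorem IsAC.exists_primitive (hu : IsAC a α β u) (hαβ : α ≤ β) :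
    ∃ M : ℝ → ℝ, IsMajorant (fun s t => a (t - s) (u s) (u t)) α β M ∧
      ∫ x in α..β, deriv M x = M β - M α := by
  obtain ⟨g, hg, hag⟩ := hu
  have hgi := (intervalIntegrable_iff_integrableOn_Ioo_of_le hαβ).2 hg
  refine ⟨fun t => ∫ r in α..t, g r, fun s t hs hst ht => ?_, ?_⟩
  · refine (hag s t hs hst ht).trans_eq ?_
    rw [intervalIntegral.integral_interval_sub_left]
    · exact hgi.mono_set (uIcc_subset_uIcc_left (by simp [uIcc_of_le hαβ]; constructor <;> linarith))
    · exact hgi.mono_set (uIcc_subset_uIcc_left (by simp [uIcc_of_le hαβ]; constructor <;> linarith))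
  · simp [integral_deriv_primitive hgi]

/-- For an absolutely continuous curve the action density exists almost everywhere, it is
integrable, and its integral lies between the cost of the end points and the increment of any
majorant of the costs along the curve. -/
theorem IsAC.hasActionDensity (hu : IsAC a α β u) (ha : IsActionCost a) (hαβ : α < β) :
    HasActionDensity a α β u ∧ IntervalIntegrable (actionDensity a u) volume α β ∧
      a (β - α) (u α) (u β) ≤ ∫ t in α..β, actionDensity a u t ∧
      ∀ M, IsMajorant (fun s t => a (t - s) (u s) (u t)) α β M →
        ∫ t in α..β, actionDensity a u t ≤ M β - M α := by
  obtain ⟨N, hN, hNi⟩ := hu.exists_primitive hαβ.le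
  have hF := ha.isSubadditiveOn_curve u α β
  set F : ℝ → ℝ → ℝ := fun s t => a (t - s) (u s) (u t) with hFdef
  set V := intervalVariation F α with hVdef
  have hV : IsMajorant F α β V := hN.intervalVariation
  have hVmono := hV.monotoneOn hF
  have hlim := hN.ae_tendsto hαβ.le hF
  have heq : ∀ᵐ x ∂volume.restrict (Ioo α β), actionDensity a u x = deriv V x := by
    filter_upwards [hlim] with x hx
    exact hx.1.limUnder_eq
  have hInt : ∫ t in α..β, actionDensity a u t = ∫ t in α..β, deriv V t := by
    rw [intervalIntegral.integral_of_le hαβ.le, intervalIntegral.integral_of_le hαβ.le,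
      integral_Ioc_eq_integral_Ioo, integral_Ioc_eq_integral_Ioo]
    exact integral_congr_ae heq
  obtain ⟨hVint, hVle⟩ := integral_deriv_le_of_monotoneOn hαβ.le hVmono
  refine ⟨?_, ?_, ?_, ?_⟩
  · filter_upwards [hlim, heq] with x hx hxe
    rw [hxe]
    exact hx
  · rw [intervalIntegrable_iff_integrableOn_Ioo_of_le hαβ.le] at hVint ⊢
    exact hVint.congr (heq.mono fun x hx => hx.symm)
  · have hNV : MonotoneOn (fun t => N t - V t) (Icc α β) := by
      intro s hs t ht hst
      rcases hst.eq_or_lt with rfl | hst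
      · exact le_rfl
      · have := hN.intervalVariation_sub_le hF hs.1 hst ht.2
        simp only
        linarith
    have h1 := sub_le_integral_deriv_add hαβ.le hVmono (hN.monotoneOn hF) hNV
    have h2 := hV α β le_rfl hαβ le_rfl
    simp only [hFdef] at h2
    linarith
  · intro M hM
    have := hM.intervalVariation_sub_le hF le_rfl hαβ le_rfl
    linarith


/-! ### Lower semicontinuity and exact mid-points -/

variable {X : Type*} {a : ℝ → X → X → ℝ}

theorem IsActionCost.self (ha : IsActionCost a) {τ : ℝ} (hτ : 0 < τ) (u : X) : a τ u u = 0 :=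
  (ha.eq_zero_iff τ hτ u u).2 rfl

theorem IsActionCost.anti (ha : IsActionCost a) {s t : ℝ} (hs : 0 < s) (hst : s ≤ t) (u v : X) :
    a t u v ≤ a s u v := by
  rcases hst.eq_or_lt with rfl | hst
  · exact le_rfl
  · have h := ha.concat s (t - s) hs (sub_pos.2 hst) u v v
    rw [ha.self (sub_pos.2 hst)] at h
    simpa using h

theorem ConvergesTo.eq_of_const {w : X} {u : X} (ha : IsActionCost a)
    (h : ConvergesTo a (fun _ => w) u) : u = w := by
  refine (ha.eq_zero_iff 1 one_pos u w).1 (le_antisymm (le_of_forall_pos_le_add fun c hc => ?_)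
    (ha.nonneg 1 one_pos u w))
  obtain ⟨N, hN⟩ := h 1 one_pos c hc
  linarith [hN N le_rfl]

/-- Every pair of sequences has a cluster pair at which the cost is lower semicontinuous. -/
def HasLscClusters (a : ℝ → X → X → ℝ) : Prop :=
  ∀ x y : ℕ → X, ∃ (𝒰 : Filter ℕ) (u v : X), 𝒰.NeBot ∧ 𝒰 ≤ atTop ∧ ∀ ρ, 0 < ρ →
    (∀ c < a ρ u v, ∀ᶠ n in 𝒰, c < a ρ (x n) (y n)) ∧
    (∀ w, ∀ c < a ρ w u, ∀ᶠ n in 𝒰, c < a ρ w (x n)) ∧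
    (∀ w, ∀ c < a ρ w v, ∀ᶠ n in 𝒰, c < a ρ w (y n))

theorem IsSeqLowerSemicontinuous.hasLscClusters [TopologicalSpace X] [SeqCompactSpace X]
    (h : IsSeqLowerSemicontinuous a) : HasLscClusters a := by
  intro x y
  obtain ⟨u, -, φ, hφ, hu⟩ := SeqCompactSpace.isSeqCompact_univ (x := x) fun n => mem_univ _
  obtain ⟨v, -, θ, hθ, hv⟩ := SeqCompactSpace.isSeqCompact_univ (x := y ∘ φ) fun n => mem_univ _
  have key : ∀ ρ, 0 < ρ → ∀ (p q : ℕ → X) (r s : X), Tendsto p atTop (𝓝 r) →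
      Tendsto q atTop (𝓝 s) → ∀ c < a ρ r s, ∀ᶠ n in atTop, c < a ρ (p n) (q n) := by
    intro ρ hρ p q r s hp hq c hc
    have h1 : ((c : ℝ) : EReal) < liminf (fun n => ((a ρ (p n) (q n) : ℝ) : EReal)) atTop :=
      (EReal.coe_lt_coe_iff.2 hc).trans_le (h ρ hρ p q r s hp hq)
    filter_upwards [eventually_lt_of_lt_liminf h1] with n hn using EReal.coe_lt_coe_iff.1 hn
  have hu' : Tendsto (fun n => x (φ (θ n))) atTop (𝓝 u) := hu.comp hθ.tendsto_atTop
  refine ⟨map (φ ∘ θ) atTop, u, v, inferInstance, (hφ.comp hθ).tendsto_atTop,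
    fun ρ hρ => ⟨fun c hc => ?_, fun w c hc => ?_, fun w c hc => ?_⟩⟩
  · exact eventually_map.2 (key ρ hρ _ _ _ _ hu' hv c hc)
  · exact eventually_map.2 (key ρ hρ _ _ _ _ (tendsto_const_nhds (x := w)) hu' c hc)
  · exact eventually_map.2 (key ρ hρ _ _ _ _ (tendsto_const_nhds (x := w)) hv c hc)

/-- A compact space need not have convergent subsequences, so the limit is taken along an
ultrafilter finer than `atTop`. -/
theorem hasLscClusters_of_compactSpace [TopologicalSpace X] [CompactSpace X]
    (h : ∀ τ, 0 < τ → LowerSemicontinuous (fun p : X × X => a τ p.1 p.2)) :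
    HasLscClusters a := by
  intro x y
  obtain ⟨⟨u, v⟩, -, hz⟩ := isCompact_univ.ultrafilter_le_nhds
    ((Ultrafilter.of (atTop : Filter ℕ)).map fun n => (x n, y n)) (by simp)
  have hz' : Tendsto (fun n => (x n, y n)) (Ultrafilter.of (atTop : Filter ℕ) : Filter ℕ)
    (𝓝 (u, v)) := hz
  refine ⟨(Ultrafilter.of (atTop : Filter ℕ) : Filter ℕ), u, v, inferInstance,
    Ultrafilter.of_le atTop,
    fun ρ hρ => ⟨fun c hc => ?_, fun w c hc => ?_, fun w c hc => ?_⟩⟩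
  · exact hz'.eventually (h ρ hρ (u, v) c hc)
  · exact (tendsto_const_nhds.prodMk_nhds ((continuous_fst.tendsto _).comp hz')).eventually
      (h ρ hρ (w, u) c hc)
  · exact (tendsto_const_nhds.prodMk_nhds ((continuous_snd.tendsto _).comp hz')).eventually
      (h ρ hρ (w, v) c hc)

/-- The cluster points must be the `a`-limits: otherwise semicontinuity would keep `a 1 u (x n)`
away from zero along the filter. Semicontinuity at `(u, v)` then applies. -/
theorem HasLscClusters.le_of_tendsto (hlsc : HasLscClusters a) (ha : IsActionCost a)
    {x y : ℕ → X} {u v : X} (hx : ConvergesTo a x u) (hy : ConvergesTo a y v) {ρ : ℝ}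
    (hρ : 0 < ρ) {B : ℕ → ℝ} {B' : ℝ} (hle : ∀ᶠ n in atTop, a ρ (x n) (y n) ≤ B n)
    (hB : Tendsto B atTop (𝓝 B')) : a ρ u v ≤ B' := by
  obtain ⟨𝒰, u', v', hne, h𝒰, hl⟩ := hlsc x y
  have huniq : ∀ (z : ℕ → X) (w w' : X), ConvergesTo a z w →
      (∀ c < a 1 w w', ∀ᶠ n in 𝒰, c < a 1 w (z n)) → w = w' := by
    intro z w w' hz hc
    by_contra hww
    have hpos : 0 < a 1 w w' := (ha.nonneg 1 one_pos w w').lt_of_ne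
      fun h => hww ((ha.eq_zero_iff 1 one_pos w w').1 h.symm)
    obtain ⟨N, hN⟩ := hz 1 one_pos (a 1 w w' / 2) (by linarith)
    obtain ⟨n, hn1, hn2⟩ := ((hc (a 1 w w' / 2) (by linarith)).and
      (h𝒰 (eventually_ge_atTop N))).exists
    linarith [hN n hn2]
  obtain rfl := huniq x u u' hx fun c hc => (hl 1 one_pos).2.1 u c hc
  obtain rfl := huniq y v v' hy fun c hc => (hl 1 one_pos).2.2 v c hc
  by_contra! hlt
  obtain ⟨c, hc1, hc2⟩ := exists_between hlt
  obtain ⟨n, h1, h2, h3⟩ := (((hl ρ hρ).1 c hc2).and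
    ((hle.and ((tendsto_order.1 hB).2 c hc1)).filter_mono h𝒰)).exists
  linarith

/-- A cluster point of approximate mid-points with errors `1 / (n + 1)` gives one inequality by
semicontinuity; concatenation gives the other. -/
theorem HasLscClusters.exists_midpoint (hlsc : HasLscClusters a) (ha : IsActionCost a)
    (hmid : HasApproxMidpoints a) {ρ : ℝ} (hρ : 0 < ρ) (u v : X) :
    ∃ w, a (ρ / 2) u w + a (ρ / 2) w v = a ρ u v := by
  have hρ2 : 0 < ρ / 2 := half_pos hρ
  choose w hw using fun n : ℕ => hmid ρ hρ u v (1 / ((n : ℝ) + 1)) (by positivity)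
  obtain ⟨𝒰, w', _, hne, h𝒰, hl⟩ := hlsc w w
  have hev : ∀ ε > 0, ∀ᶠ n : ℕ in 𝒰, 1 / ((n : ℝ) + 1) < ε := fun ε hε =>
    ((tendsto_order.1 tendsto_one_div_add_atTop_nhds_zero_nat).2 ε hε).filter_mono h𝒰
  refine ⟨w', le_antisymm ?_ ?_⟩
  · refine le_of_forall_pos_le_add fun ε hε => ?_
    obtain ⟨n, h1, h2, h3⟩ := (((hl _ hρ2).2.1 u (a (ρ / 2) u w' - ε / 3) (by linarith)).and
      (((hl _ hρ2).2.1 v (a (ρ / 2) v w' - ε / 3) (by linarith)).and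
      (hev (ε / 3) (by linarith)))).exists
    have := hw n
    rw [ha.symm _ hρ2 (w n) v] at this
    rw [ha.symm _ hρ2 w' v]
    linarith
  · simpa using ha.concat (ρ / 2) (ρ / 2) hρ2 hρ2 u w' v

/-! ### Dyadic nets and their limit curve -/

/-- The net of dyadic points obtained from `u₀`, `u₁` by iterated insertion of mid-points; the
point with index `k` at level `n` belongs to the time `k * τ / 2 ^ n`. -/
noncomputable def dyadicNet (mid : ℝ → X → X → X) (τ : ℝ) (u₀ u₁ : X) : ℕ → ℕ → X
  | 0, k => if k = 0 then u₀ else u₁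
  | n + 1, k => if k % 2 = 0 then dyadicNet mid τ u₀ u₁ n (k / 2) else
      mid (τ / 2 ^ n) (dyadicNet mid τ u₀ u₁ n (k / 2)) (dyadicNet mid τ u₀ u₁ n (k / 2 + 1))

/-- The cost of the first `k` steps of length `τ / 2 ^ n` of the net `d`. -/
noncomputable def netCost (a : ℝ → X → X → ℝ) (τ : ℝ) (d : ℕ → ℕ → X) (n k : ℕ) : ℝ :=
  ∑ i ∈ Finset.range k, a (τ / 2 ^ n) (d n i) (d n (i + 1))

section Net

variable {mid : ℝ → X → X → X} {τ : ℝ} {u₀ u₁ : X}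

theorem dyadicNet_two_mul (n k : ℕ) :
    dyadicNet mid τ u₀ u₁ (n + 1) (2 * k) = dyadicNet mid τ u₀ u₁ n k := by
  simp [dyadicNet]

theorem dyadicNet_two_mul_add_one (n k : ℕ) :
    dyadicNet mid τ u₀ u₁ (n + 1) (2 * k + 1) =
      mid (τ / 2 ^ n) (dyadicNet mid τ u₀ u₁ n k) (dyadicNet mid τ u₀ u₁ n (k + 1)) := by
  have h1 : (2 * k + 1) / 2 = k := by omega
  have h2 : (2 * k + 1) % 2 = 1 := by omega
  simp [dyadicNet, h1, h2]

theorem dyadicNet_zero_right (n : ℕ) : dyadicNet mid τ u₀ u₁ n 0 = u₀ := by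
  induction n with
  | zero => simp [dyadicNet]
  | succ n ih => exact (dyadicNet_two_mul n 0).trans ih

theorem dyadicNet_two_pow (n : ℕ) : dyadicNet mid τ u₀ u₁ n (2 ^ n) = u₁ := by
  induction n with
  | zero => simp [dyadicNet]
  | succ n ih => rw [pow_succ, mul_comm, dyadicNet_two_mul, ih]

theorem netCost_mono (ha : IsActionCost a) (hτ : 0 < τ) (d : ℕ → ℕ → X) (n : ℕ) :
    Monotone (netCost a τ d n) := by
  refine monotone_nat_of_le_succ fun k => ?_
  rw [netCost, netCost, Finset.sum_range_succ]
  linarith [ha.nonneg (τ / 2 ^ n) (by positivity) (d n k) (d n (k + 1))]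

theorem cost_le_netCost_sub (ha : IsActionCost a) (hτ : 0 < τ) (d : ℕ → ℕ → X) (n i j : ℕ) :
    a (((j : ℝ) + 1) * (τ / 2 ^ n)) (d n i) (d n (i + j + 1)) ≤
      netCost a τ d n (i + j + 1) - netCost a τ d n i := by
  have hh : 0 < τ / 2 ^ n := by positivity
  induction j with
  | zero => simp [netCost, Finset.sum_range_succ]
  | succ j ih =>
    have h1 := ha.concat (((j : ℝ) + 1) * (τ / 2 ^ n)) (τ / 2 ^ n) (by positivity) hh
      (d n i) (d n (i + j + 1)) (d n (i + j + 1 + 1))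
    have h2 : netCost a τ d n (i + j + 1 + 1) = netCost a τ d n (i + j + 1) +
        a (τ / 2 ^ n) (d n (i + j + 1)) (d n (i + j + 1 + 1)) := Finset.sum_range_succ _ _
    push_cast
    rw [show ((j : ℝ) + 1 + 1) * (τ / 2 ^ n) = ((j : ℝ) + 1) * (τ / 2 ^ n) + τ / 2 ^ n by ring,
      ← add_assoc i j 1, h2]
    linarith

/-- Since mid-points are exact, the two halves of a step cost together as much as the step. -/
theorem netCost_dyadicNet_two_mul
    (hmid : ∀ ρ, 0 < ρ → ∀ u v, a (ρ / 2) u (mid ρ u v) + a (ρ / 2) (mid ρ u v) v = a ρ u v)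
    (hτ : 0 < τ) (n k : ℕ) :
    netCost a τ (dyadicNet mid τ u₀ u₁) (n + 1) (2 * k) =
      netCost a τ (dyadicNet mid τ u₀ u₁) n k := by
  induction k with
  | zero => simp [netCost]
  | succ k ih =>
    have h := hmid (τ / 2 ^ n) (by positivity) (dyadicNet mid τ u₀ u₁ n k)
      (dyadicNet mid τ u₀ u₁ n (k + 1))
    have e : τ / 2 ^ (n + 1) = τ / 2 ^ n / 2 := by rw [pow_succ, div_div]
    rw [show 2 * (k + 1) = 2 * k + 1 + 1 by ring]
    unfold netCost at ih ⊢
    rw [Finset.sum_range_succ, Finset.sum_range_succ, Finset.sum_range_succ, ih, e,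
      show 2 * k + 1 + 1 = 2 * (k + 1) by ring, dyadicNet_two_mul, dyadicNet_two_mul,
      dyadicNet_two_mul_add_one, ← h]
    ring

/-- At level `0` all points after the first are `u₁`, so steps beyond the end are free and no bound
on `k` is needed. At higher levels `k` is rounded up to an even index. -/
theorem netCost_dyadicNet_le (ha : IsActionCost a)
    (hmid : ∀ ρ, 0 < ρ → ∀ u v, a (ρ / 2) u (mid ρ u v) + a (ρ / 2) (mid ρ u v) v = a ρ u v)
    (hτ : 0 < τ) (n k : ℕ) :
    netCost a τ (dyadicNet mid τ u₀ u₁) n k ≤ a τ u₀ u₁ := by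
  induction n generalizing k with
  | zero =>
    rcases k with _ | k
    · simpa [netCost] using ha.nonneg τ hτ u₀ u₁
    · rw [netCost, Finset.sum_range_succ']
      simp [dyadicNet, ha.self hτ]
  | succ n ih =>
    refine (netCost_mono ha hτ _ (n + 1) (show k ≤ 2 * (k / 2 + 1) by omega)).trans ?_
    rw [netCost_dyadicNet_two_mul hmid hτ]
    exact ih _

end Net

theorem natFloor_two_mul_eq_or (x : ℝ) : ⌊2 * x⌋₊ = 2 * ⌊x⌋₊ ∨ ⌊2 * x⌋₊ = 2 * ⌊x⌋₊ + 1 := by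
  rcases le_or_gt 0 x with hx | hx
  · have h1 := Nat.floor_le hx
    have h2 := Nat.lt_floor_add_one x
    have h3 : 2 * ⌊x⌋₊ ≤ ⌊2 * x⌋₊ := Nat.le_floor (by push_cast; linarith)
    have h4 : ⌊2 * x⌋₊ < 2 * ⌊x⌋₊ + 2 :=
      (Nat.floor_lt (by linarith)).2 (by push_cast; linarith)
    omega
  · left
    rw [Nat.floor_of_nonpos hx.le, Nat.floor_of_nonpos (by linarith)]

/-- A complete action cost with exact mid-points, lower semicontinuity, and the property that
points of bounded cost in short time are close, has curves along which the costs are dominated by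
the increments of a function of total increment `a τ u₀ u₁`. -/
theorem exists_curve_isMajorant (ha : IsActionCost a) (hcomplete : IsCompleteCost a)
    (hlsc : HasLscClusters a)
    (hmid : ∀ ρ, 0 < ρ → ∀ u v, ∃ w, a (ρ / 2) u w + a (ρ / 2) w v = a ρ u v)
    (hshort : ∀ A c ε : ℝ, 0 < c → 0 < ε → ∃ δ > 0, ∀ h, 0 < h → h < δ → ∀ u v,
      a h u v ≤ A → a c u v < ε)
    {τ : ℝ} (hτ : 0 < τ) (u₀ u₁ : X) :
    ∃ (ω : ℝ → X) (m : ℝ → ℝ), ω 0 = u₀ ∧ ω τ = u₁ ∧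
      IsMajorant (fun s t => a (t - s) (ω s) (ω t)) 0 τ m ∧ m τ - m 0 ≤ a τ u₀ u₁ := by
  have hmid' : ∃ mid : ℝ → X → X → X, ∀ ρ, 0 < ρ → ∀ u v,
      a (ρ / 2) u (mid ρ u v) + a (ρ / 2) (mid ρ u v) v = a ρ u v := by
    have : ∀ ρ u v, ∃ w, 0 < ρ → a (ρ / 2) u w + a (ρ / 2) w v = a ρ u v := fun ρ u v => by
      by_cases hρ : 0 < ρ
      · obtain ⟨w, hw⟩ := hmid ρ hρ u v
        exact ⟨w, fun _ => hw⟩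
      · exact ⟨u, fun h => absurd h hρ⟩
    choose mid hm using this
    exact ⟨mid, fun ρ hρ u v => hm ρ u v hρ⟩
  obtain ⟨mid, hmid⟩ := hmid'
  set d := dyadicNet mid τ u₀ u₁ with hd
  set S := netCost a τ d with hS
  have hSle : ∀ n k, S n k ≤ a τ u₀ u₁ := netCost_dyadicNet_le ha hmid hτ
  have hS2 : ∀ n k, S (n + 1) (2 * k) = S n k := netCost_dyadicNet_two_mul hmid hτ
  have hd2 : ∀ n k, d (n + 1) (2 * k) = d n k := dyadicNet_two_mul
  have hSmono : ∀ n, Monotone (S n) := netCost_mono ha hτ d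
  have hcost : ∀ n i j : ℕ, a (((j : ℝ) + 1) * (τ / 2 ^ n)) (d n i) (d n (i + j + 1)) ≤
    S n (i + j + 1) - S n i := cost_le_netCost_sub ha hτ d
  have hS0 : ∀ n, S n 0 = 0 := fun n => by simp [hS, netCost]
  have hpos : ∀ n : ℕ, 0 < τ / 2 ^ n := fun n => by positivity
  -- Index of the last dyadic point of level `n` not after `t`.
  let c : ℝ → ℕ → ℕ := fun t n => ⌊2 ^ n * t / τ⌋₊
  have hc : ∀ t n, c t (n + 1) = 2 * c t n ∨ c t (n + 1) = 2 * c t n + 1 := fun t n => by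
    have := natFloor_two_mul_eq_or (2 ^ n * t / τ)
    rwa [show 2 * (2 ^ n * t / τ) = 2 ^ (n + 1) * t / τ by rw [pow_succ]; ring] at this
  have hμmono : ∀ t, Monotone fun n => S n (c t n) := fun t =>
    monotone_nat_of_le_succ fun n => by
      rw [← hS2]
      exact hSmono _ (by rcases hc t n with h | h <;> omega)
  have hμbdd : ∀ t, BddAbove (range fun n => S n (c t n)) := fun t =>
    ⟨_, by rintro _ ⟨n, rfl⟩; exact hSle _ _⟩
  let m : ℝ → ℝ := fun t => ⨆ n, S n (c t n)
  have hμ : ∀ t, Tendsto (fun n => S n (c t n)) atTop (𝓝 (m t)) := fun t =>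
    tendsto_atTop_ciSup (hμmono t) (hμbdd t)
  have hstep : ∀ t n, a (τ / 2 ^ (n + 1)) (d n (c t n)) (d (n + 1) (c t (n + 1))) ≤
      S (n + 1) (c t (n + 1)) - S n (c t n) := by
    intro t n
    rcases hc t n with h | h
    · rw [h, hd2, hS2, ha.self (hpos _), sub_self]
    · have := hcost (n + 1) (2 * c t n) 0
      rw [h, ← hd2 n, ← hS2 n]
      simpa using this
  -- The refinement steps take times `τ / 2 ^ (n + 1)`, ..., `τ / 2 ^ (n + j + 1)`, whose sum is the
  -- duration stated here.
  have hchain : ∀ t n j, a (τ / 2 ^ n - τ / 2 ^ (n + j + 1)) (d n (c t n))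
      (d (n + j + 1) (c t (n + j + 1))) ≤ S (n + j + 1) (c t (n + j + 1)) - S n (c t n) := by
    intro t n j
    induction j with
    | zero =>
      convert hstep t n using 2
      simp only [add_zero, pow_succ]
      field_simp
      ring
    | succ j ih =>
      have hlt : τ / 2 ^ (n + j + 1) < τ / 2 ^ n := by
        gcongr
        · norm_num
        · omega
      have h1 := ha.concat (τ / 2 ^ n - τ / 2 ^ (n + j + 1)) (τ / 2 ^ (n + j + 1 + 1))
        (by linarith) (hpos _) (d n (c t n)) (d (n + j + 1) (c t (n + j + 1)))
        (d (n + j + 1 + 1) (c t (n + j + 1 + 1)))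
      rw [show τ / 2 ^ n - τ / 2 ^ (n + j + 1) + τ / 2 ^ (n + j + 1 + 1) =
        τ / 2 ^ n - τ / 2 ^ (n + j + 1 + 1) by rw [pow_succ _ (n + j + 1)]; ring] at h1
      rw [← add_assoc n j 1]
      linarith [hstep t (n + j + 1)]
  have htime : Tendsto (fun n : ℕ => τ / 2 ^ n) atTop (𝓝 0) := by
    have := (tendsto_pow_atTop_nhds_zero_of_lt_one (r := (1 / 2 : ℝ)) (by norm_num)
      (by norm_num)).const_mul τ
    simpa [div_eq_mul_inv] using this
  -- Refining from level `n` on takes time less than `κ` for large `n`, and costs at most the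
  -- increment of a convergent sequence.
  have hlt : ∀ t κ, 0 < κ → ∀ ε, 0 < ε → ∃ N, ∀ n, N ≤ n → ∀ k, n < k →
      a κ (d n (c t n)) (d k (c t k)) < ε := by
    intro t κ hκ ε hε
    obtain ⟨N, hN⟩ := eventually_atTop.1 (((tendsto_order.1 htime).2 κ hκ).and
      ((tendsto_order.1 (hμ t)).1 (m t - ε) (by linarith)))
    refine ⟨N, fun n hn k hk => ?_⟩
    obtain ⟨j, rfl⟩ := Nat.exists_eq_add_of_lt hk
    have hlt : τ / 2 ^ (n + j + 1) < τ / 2 ^ n := by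
      gcongr
      norm_num
    have h1 := ha.anti (s := τ / 2 ^ n - τ / 2 ^ (n + j + 1)) (t := κ) (by linarith)
      (by linarith [(hN n hn).1, hpos (n + j + 1)]) (d n (c t n))
      (d (n + j + 1) (c t (n + j + 1)))
    have h2 : S (n + j + 1) (c t (n + j + 1)) ≤ m t := le_ciSup (hμbdd t) (n + j + 1)
    linarith [hchain t n j, (hN n hn).2]
  have hcauchy : ∀ t, IsCauchySeq a fun n => d n (c t n) := by
    intro t κ hκ ε hε
    obtain ⟨N, hN⟩ := hlt t κ hκ ε hε
    refine ⟨N, fun p hp q hq => ?_⟩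
    rcases lt_trichotomy p q with h | h | h
    · exact hN p hp q h
    · subst h
      simpa [ha.self hκ] using hε
    · simp only [ha.symm κ hκ (d p (c t p))]
      exact hN q hq p h
  choose ω hω using fun t => hcomplete _ (hcauchy t)
  -- The right neighbours have the same limit: one step has bounded cost in vanishing time, so
  -- `hshort` applies.
  have hωnext : ∀ t, ConvergesTo a (fun n => d n (c t n + 1)) (ω t) := by
    intro t κ hκ ε hε
    obtain ⟨N₁, hN₁⟩ := hω t (κ / 2) (by linarith) (ε / 2) (by linarith)
    obtain ⟨δ, hδ, hsh⟩ := hshort (a τ u₀ u₁) (κ / 2) (ε / 2) (by linarith) (by linarith)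
    obtain ⟨N₂, hN₂⟩ := eventually_atTop.1 ((tendsto_order.1 htime).2 δ hδ)
    refine ⟨max N₁ N₂, fun n hn => ?_⟩
    have h1 := hN₁ n (le_trans (le_max_left _ _) hn)
    have h2 := hcost n (c t n) 0
    simp only [Nat.cast_zero, zero_add, one_mul, add_zero] at h2
    have h3 := hsh (τ / 2 ^ n) (hpos n) (hN₂ n (le_trans (le_max_right _ _) hn)) _ _
      (h2.trans (by linarith [hSle n (c t n + 1), hSmono n (Nat.zero_le (c t n)), hS0 n]))
    have h4 := ha.concat (κ / 2) (κ / 2) (by linarith) (by linarith) (ω t) (d n (c t n))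
      (d n (c t n + 1))
    rw [add_halves] at h4
    linarith
  refine ⟨ω, m, ?_, ?_, ?_, ?_⟩
  · refine ConvergesTo.eq_of_const ha ?_
    have := hω 0
    simpa [c, hd, dyadicNet_zero_right] using this
  · refine ConvergesTo.eq_of_const ha ?_
    have h := hω τ
    have hcτ : ∀ n, c τ n = 2 ^ n := fun n => by
      simp only [c]
      rw [mul_div_cancel_right₀ _ hτ.ne']
      exact_mod_cast Nat.floor_natCast (R := ℝ) (2 ^ n)
    simpa [hcτ, hd, dyadicNet_two_pow] using h
  -- The right neighbour of `s` and the left neighbour of `t` are at most `t - s` apart in time. As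
  -- costs decrease in time, the net cost between them bounds `a (t - s)`.
  · intro s t hs hst ht
    refine hlsc.le_of_tendsto ha (hωnext s) (hω t) (sub_pos.2 hst) ?_ ((hμ t).sub (hμ s))
    filter_upwards [(tendsto_order.1 htime).2 (t - s) (sub_pos.2 hst)] with n hn
    have hp : (0 : ℝ) < 2 ^ n := by positivity
    have hs0 : 0 ≤ 2 ^ n * s / τ := by positivity
    have ht0 : 0 ≤ 2 ^ n * t / τ := div_nonneg (mul_nonneg hp.le (by linarith)) hτ.le
    have e1 : (c t n : ℝ) ≤ 2 ^ n * t / τ := Nat.floor_le ht0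
    have e2 : 2 ^ n * s / τ < c s n + 1 := Nat.lt_floor_add_one _
    have e3 : c s n + 1 ≤ c t n := by
      rw [← Nat.floor_add_one hs0]
      refine Nat.floor_le_floor ?_
      rw [div_lt_iff₀ hp] at hn
      rw [div_add_one hτ.ne']
      gcongr
      linarith
    have e4 : S n (c s n) ≤ S n (c s n + 1) := hSmono n (Nat.le_succ _)
    rcases e3.eq_or_lt with h | h
    · rw [← h, ha.self (sub_pos.2 hst)]
      linarith
    · obtain ⟨j, hj⟩ := Nat.exists_eq_add_of_lt h
      have h1 := hcost n (c s n + 1) j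
      rw [← hj] at h1
      have h2 : ((j : ℝ) + 1) * (τ / 2 ^ n) ≤ t - s := by
        have hj' : (c t n : ℝ) = c s n + 1 + j + 1 := by exact_mod_cast hj
        have : (j : ℝ) + 1 ≤ 2 ^ n * t / τ - 2 ^ n * s / τ := by linarith
        calc ((j : ℝ) + 1) * (τ / 2 ^ n)
            ≤ (2 ^ n * t / τ - 2 ^ n * s / τ) * (τ / 2 ^ n) := by gcongr
          _ = t - s := by field_simp
      exact (ha.anti (by positivity) h2 _ _).trans (by linarith)
  · have h0 : m 0 = 0 := by simp [m, c, hS0]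
    rw [h0, sub_zero]
    exact ciSup_le fun n => hSle _ _


/-! ### Convex superlinear functions -/

section Convex

variable {ψ : ℝ → ℝ}

theorem map_mul_le_of_convexOn (hψ : ConvexOn ℝ (Ici 0) ψ) (h0 : ψ 0 = 0) {θ r : ℝ}
    (hθ0 : 0 ≤ θ) (hθ1 : θ ≤ 1) (hr : 0 ≤ r) : ψ (θ * r) ≤ θ * ψ r := by
  have := hψ.2 (mem_Ici.2 hr) (mem_Ici.2 le_rfl) hθ0 (sub_nonneg.2 hθ1) (by ring)
  simpa [h0] using this

theorem monotoneOn_of_convexOn (hψ : ConvexOn ℝ (Ici 0) ψ) (h0 : ψ 0 = 0)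
    (hnn : ∀ r, 0 ≤ r → 0 ≤ ψ r) : MonotoneOn ψ (Ici 0) := by
  intro x hx y hy hxy
  rcases (mem_Ici.1 hy).eq_or_lt with h | h
  · rw [show x = y from le_antisymm hxy (h ▸ hx)]
  · have h1 := map_mul_le_of_convexOn hψ h0 (div_nonneg hx h.le) ((div_le_one h).2 hxy) h.le
    rw [div_mul_cancel₀ _ h.ne'] at h1
    exact h1.trans (mul_le_of_le_one_left (hnn y h.le) ((div_le_one h).2 hxy))

/-- Only continuity at `0` needs an argument: there `0 ≤ ψ r ≤ r * ψ 1`. -/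
theorem continuousOn_of_convexOn (hψ : ConvexOn ℝ (Ici 0) ψ) (h0 : ψ 0 = 0)
    (hnn : ∀ r, 0 ≤ r → 0 ≤ ψ r) : ContinuousOn ψ (Ici 0) := by
  refine hψ.continuousOn_Ici ?_
  rw [ContinuousWithinAt, h0]
  have hlim : Tendsto (fun r : ℝ => r * ψ 1) (𝓝[≥] 0) (𝓝 0) := by
    have : Tendsto (fun r : ℝ => r * ψ 1) (𝓝 0) (𝓝 (0 * ψ 1)) :=
      (continuous_id.mul continuous_const).tendsto 0
    rw [zero_mul] at this
    exact this.mono_left nhdsWithin_le_nhds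
  refine tendsto_of_tendsto_of_tendsto_of_le_of_le' tendsto_const_nhds hlim ?_ ?_
  · filter_upwards [self_mem_nhdsWithin] with r hr using hnn r hr
  · filter_upwards [self_mem_nhdsWithin, nhdsWithin_le_nhds (Iio_mem_nhds one_pos)]
      with r (hr : 0 ≤ r) (hr1 : r < 1)
    simpa using map_mul_le_of_convexOn hψ h0 hr hr1.le zero_le_one

theorem exists_le_add_of_superlinear (hnn : ∀ r, 0 ≤ r → 0 ≤ ψ r)
    (hlim : Tendsto (fun r => ψ r / r) atTop atTop) {ε : ℝ} (hε : 0 < ε) :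
    ∃ M, 0 ≤ M ∧ ∀ r, 0 ≤ r → r ≤ M + ε * ψ r := by
  obtain ⟨R, hR⟩ := eventually_atTop.1 (hlim.eventually_ge_atTop ε⁻¹)
  refine ⟨max R 1, by positivity, fun r hr => ?_⟩
  rcases le_or_gt r (max R 1) with h | h
  · exact h.trans (le_add_of_nonneg_right (mul_nonneg hε.le (hnn r hr)))
  · have h1 : 0 < r := lt_of_lt_of_le one_pos ((le_max_right R 1).trans h.le)
    have h2 := hR r ((le_max_left R 1).trans h.le)
    rw [le_div_iff₀ h1, inv_mul_le_iff₀ hε] at h2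
    exact h2.trans (le_add_of_nonneg_left (by positivity))

/-- Jensen's inequality for a convex function on `[0, ∞)` and an interval. -/
theorem sub_mul_map_le_integral (hψ : ConvexOn ℝ (Ici 0) ψ) (h0 : ψ 0 = 0)
    (hnn : ∀ r, 0 ≤ r → 0 ≤ ψ r) {f : ℝ → ℝ} {s t B : ℝ} (hst : s < t)
    (hf0 : ∀ x ∈ Ioo s t, 0 ≤ f x) (hf : IntegrableOn f (Ioo s t))
    (hψf : IntegrableOn (ψ ∘ f) (Ioo s t)) (hB0 : 0 ≤ B) (hB : B ≤ ∫ x in s..t, f x) :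
    (t - s) * ψ ((t - s)⁻¹ * B) ≤ ∫ x in s..t, ψ (f x) := by
  have hts : 0 < t - s := sub_pos.2 hst
  have hvol : volume.real (Ioo s t) = t - s := by simp [hst.le]
  rw [intervalIntegral.integral_of_le hst.le, integral_Ioc_eq_integral_Ioo] at hB ⊢
  have hJ := hψ.map_set_average_le (continuousOn_of_convexOn hψ h0 hnn) isClosed_Ici
    (μ := volume) (t := Ioo s t) (f := f) (by simp [hst]) (by simp)
    (by filter_upwards [ae_restrict_mem measurableSet_Ioo] with x hx using hf0 x hx) hf hψf
  rw [setAverage_eq, setAverage_eq, hvol, smul_eq_mul, smul_eq_mul] at hJ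
  have hmono : ψ ((t - s)⁻¹ * B) ≤ ψ ((t - s)⁻¹ * ∫ x in Ioo s t, f x) :=
    monotoneOn_of_convexOn hψ h0 hnn (mem_Ici.2 (by positivity))
      (mem_Ici.2 (mul_nonneg (by positivity) (hB0.trans hB))) (by gcongr)
  calc (t - s) * ψ ((t - s)⁻¹ * B)
      ≤ (t - s) * ((t - s)⁻¹ * ∫ x in Ioo s t, ψ (f x)) := by gcongr; exact hmono.trans hJ
    _ = _ := by field_simp

end Convex

/-! ### Superlinear costs and absolute continuity -/

variable {X : Type*} {a b : ℝ → X → X → ℝ} {ψ : ℝ → ℝ} {l : ℝ}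

theorem map_zero_of_superlinear (ha : IsActionCost a) (hb : IsActionCost b)
    (hnn : ∀ r, 0 ≤ r → 0 ≤ ψ r) (hl : 1 ≤ l)
    (hle : ∀ τ, 0 < τ → ∀ u v, l⁻¹ * (τ * ψ (τ⁻¹ * b τ u v)) ≤ a τ u v) (u : X) : ψ 0 = 0 := by
  have h := hle 1 one_pos u u
  rw [ha.self one_pos, hb.self one_pos, mul_zero, one_mul] at h
  have hl' : 0 < l⁻¹ := by positivity
  nlinarith [hnn 0 le_rfl, mul_nonneg hl'.le (hnn 0 le_rfl),
    nonpos_of_mul_nonpos_right h hl']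

/-- Superlinearity bounds `r` by `M + (ε / l) * ψ r`; this is taken at `r = b h u v / h`. The
freedom in `ε` serves as uniform integrability. -/
theorem exists_le_mul_add_mul (hb : IsActionCost b) (hnn : ∀ r, 0 ≤ r → 0 ≤ ψ r)
    (hlim : Tendsto (fun r => ψ r / r) atTop atTop) (hl : 1 ≤ l)
    (hle : ∀ τ, 0 < τ → ∀ u v, l⁻¹ * (τ * ψ (τ⁻¹ * b τ u v)) ≤ a τ u v) {ε : ℝ} (hε : 0 < ε) :
    ∃ M, 0 ≤ M ∧ ∀ h, 0 < h → ∀ u v, b h u v ≤ M * h + ε * a h u v := by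
  have hl0 : 0 < l := by linarith
  obtain ⟨M, hM, hMr⟩ := exists_le_add_of_superlinear hnn hlim (div_pos hε hl0)
  refine ⟨M, hM, fun h hh u v => ?_⟩
  have h1 := hMr (h⁻¹ * b h u v) (mul_nonneg (by positivity) (hb.nonneg h hh u v))
  have h2 := hle h hh u v
  calc b h u v = h * (h⁻¹ * b h u v) := by field_simp
    _ ≤ h * (M + ε / l * ψ (h⁻¹ * b h u v)) := by gcongr
    _ = M * h + ε * (l⁻¹ * (h * ψ (h⁻¹ * b h u v))) := by field_simp
    _ ≤ M * h + ε * a h u v := by gcongr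

/-- For a uniformly superlinear action cost, points of bounded cost in short time are close. -/
theorem IsUniformlySuperlinear.exists_lt_of_le (hsuper : IsUniformlySuperlinear a)
    (ha : IsActionCost a) (A c ε : ℝ) (hc : 0 < c) (hε : 0 < ε) :
    ∃ δ > 0, ∀ h, 0 < h → h < δ → ∀ u v, a h u v ≤ A → a c u v < ε := by
  obtain ⟨b, ψ, l, hb, hψ, hnn, hlim, hl, hle⟩ := hsuper
  have hl0 : 0 < l := by linarith
  have hψ1 : 0 ≤ ψ 1 := hnn 1 zero_le_one
  -- `η ≤ c` puts `b c u v / c` in `[0, 1]`, where `ψ r ≤ r * ψ 1`; the second bound then brings the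
  -- cost below `ε`.
  set η := min c (ε / (l * ψ 1 + 1)) with hη
  have hη0 : 0 < η := by positivity
  have hA : 0 < |A| + 1 := by positivity
  obtain ⟨M, hM, hMb⟩ := exists_le_mul_add_mul hb hnn hlim hl (fun τ hτ u v => (hle τ hτ u v).1)
    (show 0 < η / 2 / (|A| + 1) by positivity)
  refine ⟨min c (η / 2 / (M + 1)), by positivity, fun h hh hhδ u v hA' => ?_⟩
  have h0 : ψ 0 = 0 :=
    map_zero_of_superlinear ha hb hnn hl (fun τ hτ u v => (hle τ hτ u v).1) u
  obtain ⟨hh1, hh2⟩ := lt_min_iff.1 hhδ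
  have hbη : b c u v < η := by
    have h1 := hb.anti hh hh1.le u v
    have h2 := hMb h hh u v
    have h3 : M * h < η / 2 := by
      rw [lt_div_iff₀ (by positivity)] at hh2
      nlinarith
    have h4 : η / 2 / (|A| + 1) * a h u v ≤ η / 2 := by
      calc η / 2 / (|A| + 1) * a h u v ≤ η / 2 / (|A| + 1) * (|A| + 1) := by
            gcongr
            linarith [le_abs_self A]
        _ = η / 2 := by field_simp
    linarith
  have hb0 := hb.nonneg c hc u v
  have h1 : c⁻¹ * b c u v ≤ 1 := by
    rw [inv_mul_le_iff₀ hc, mul_one]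
    exact hbη.le.trans (min_le_left _ _)
  have h2 := map_mul_le_of_convexOn hψ h0 (by positivity) h1 zero_le_one
  rw [mul_one] at h2
  have h3 : η * (l * ψ 1 + 1) ≤ ε := by
    rw [← le_div_iff₀ (by positivity)]
    exact min_le_right _ _
  calc a c u v ≤ l * (c * ψ (c⁻¹ * b c u v)) := (hle c hc u v).2
    _ ≤ l * (c * (c⁻¹ * b c u v * ψ 1)) := by gcongr
    _ = b c u v * (l * ψ 1) := by field_simp
    _ < ε := by nlinarith [mul_nonneg hl0.le hψ1]

/-- For a uniformly superlinear action cost, a curve whose costs have a majorant is absolutely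
continuous. -/
theorem IsUniformlySuperlinear.isAC (hsuper : IsUniformlySuperlinear a) (ha : IsActionCost a)
    {ω : ℝ → X} {α β : ℝ} (hαβ : α ≤ β) {m : ℝ → ℝ}
    (hm : IsMajorant (fun s t => a (t - s) (ω s) (ω t)) α β m) : IsAC a α β ω := by
  obtain ⟨b, ψ, l, hb, hψ, hnn, hlim, hl, hle⟩ := hsuper
  have hl0 : 0 < l := by linarith
  have h0 : ψ 0 = 0 :=
    map_zero_of_superlinear ha hb hnn hl (fun τ hτ u v => (hle τ hτ u v).1) (ω α)
  have hmmono := hm.monotoneOn (ha.isSubadditiveOn_curve ω α β)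
  have hF := hb.isSubadditiveOn_curve ω α β
  set F : ℝ → ℝ → ℝ := fun s t => b (t - s) (ω s) (ω t) with hFdef
  have hmaj : ∀ ε > 0, ∃ M, IsMajorant F α β fun t => M * t + ε * m t := by
    intro ε hε
    obtain ⟨M, -, hMb⟩ :=
      exists_le_mul_add_mul hb hnn hlim hl (fun τ hτ u v => (hle τ hτ u v).1) hε
    refine ⟨M, fun s t hs hst ht => ?_⟩
    have h1 := hMb (t - s) (sub_pos.2 hst) (ω s) (ω t)
    have h2 := mul_le_mul_of_nonneg_left (hm s t hs hst ht) hε.le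
    simp only [hFdef]
    linarith
  obtain ⟨M₁, hM₁⟩ := hmaj 1 one_pos
  set V := intervalVariation F α with hVdef
  have hV : IsMajorant F α β V := hM₁.intervalVariation
  have hVmono := hV.monotoneOn hF
  have hVle : ∀ s t, α ≤ s → s < t → t ≤ β → V t - V s ≤ ∫ x in s..t, deriv V x := by
    intro s t hs hst ht
    have hsub : Icc s t ⊆ Icc α β := Icc_subset_Icc hs ht
    have hms := hmmono.mono hsub
    -- For the majorant `M * t + ε * m t` the singular mass is `ε` times that of `m`, and disappears
    -- as `ε` tends to `0`.
    have hlimε : Tendsto (fun ε : ℝ => (∫ x in s..t, deriv V x) +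
        ε * ((m t - m s) - ∫ x in s..t, deriv m x)) (𝓝[>] 0) (𝓝 (∫ x in s..t, deriv V x)) := by
      have : Continuous fun ε : ℝ => (∫ x in s..t, deriv V x) +
        ε * ((m t - m s) - ∫ x in s..t, deriv m x) := by fun_prop
      simpa using (this.tendsto 0).mono_left nhdsWithin_le_nhds
    refine ge_of_tendsto hlimε ?_
    filter_upwards [self_mem_nhdsWithin] with ε (hε : 0 < ε)
    obtain ⟨M, hM⟩ := hmaj ε hε
    have h1 := sub_le_integral_deriv_add hst.le (hVmono.mono hsub)
      ((hM.monotoneOn hF).mono hsub) (fun x hx y hy hxy => by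
        rcases hxy.eq_or_lt with rfl | hxy
        · exact le_rfl
        · have := hM.intervalVariation_sub_le hF (hsub hx).1 hxy (hsub hy).2
          simp only
          linarith)
    have h2 : ∫ x in s..t, deriv (fun t => M * t + ε * m t) x =
        ∫ x in s..t, (M + ε * deriv m x) := by
      rw [intervalIntegral.integral_of_le hst.le, intervalIntegral.integral_of_le hst.le,
        integral_Ioc_eq_integral_Ioo, integral_Ioc_eq_integral_Ioo]
      refine integral_congr_ae ?_
      filter_upwards [ae_hasDerivAt_of_monotoneOn hms] with x hx
      have h := ((hasDerivAt_id x).const_mul M).add (hx.const_mul ε)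
      rw [mul_one] at h
      exact h.deriv
    have hmi := (integral_deriv_le_of_monotoneOn hst.le hms).1
    rw [h2, intervalIntegral.integral_add intervalIntegrable_const (hmi.const_mul ε),
      intervalIntegral.integral_const, intervalIntegral.integral_const_mul, smul_eq_mul] at h1
    linarith
  have hψV : ∀ᵐ x ∂volume.restrict (Ioo α β), ψ (deriv V x) ≤ l * deriv m x := by
    filter_upwards [hM₁.ae_tendsto hαβ hF, ae_hasDerivAt_of_monotoneOn hmmono,
      ae_restrict_mem measurableSet_Ioo] with x hx hmx hxm
    have hV0 : 0 ≤ deriv V x := deriv_nonneg_of_monotoneOn_Icc hVmono hxm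
    have hquot : ∀ᶠ y in 𝓝[>] x, 0 ≤ F x y / (y - x) := by
      filter_upwards [self_mem_nhdsWithin] with y (hy : x < y)
      exact div_nonneg (hb.nonneg _ (sub_pos.2 hy) _ _) (sub_pos.2 hy).le
    have hψlim : Tendsto (fun y => ψ (F x y / (y - x))) (𝓝[>] x) (𝓝 (ψ (deriv V x))) :=
      (continuousOn_of_convexOn hψ h0 hnn _ (mem_Ici.2 hV0)).tendsto.comp
        (tendsto_nhdsWithin_iff.2 ⟨hx.1, hquot⟩)
    refine le_of_tendsto_of_tendsto hψlim ((tendsto_div_right_of_hasDerivAt hmx).const_mul l) ?_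
    filter_upwards [self_mem_nhdsWithin, nhdsWithin_le_nhds (Iio_mem_nhds hxm.2)]
      with y (hy : x < y) (hyβ : y < β)
    have hyx := sub_pos.2 hy
    have h1 := (hle (y - x) hyx (ω x) (ω y)).1.trans (hm x y hxm.1.le hy hyβ.le)
    rw [inv_mul_le_iff₀ hl0] at h1
    rw [← mul_div_assoc, le_div_iff₀ hyx, div_eq_inv_mul, mul_comm]
    exact h1
  have hVint : IntegrableOn (deriv V) (Ioo α β) :=
    (intervalIntegrable_iff_integrableOn_Ioo_of_le hαβ).1
      (integral_deriv_le_of_monotoneOn hαβ hVmono).1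
  have hψint : IntegrableOn (ψ ∘ deriv V) (Ioo α β) := by
    have hmint : IntegrableOn (fun x => l * deriv m x) (Ioo α β) :=
      ((intervalIntegrable_iff_integrableOn_Ioo_of_le hαβ).1
        (integral_deriv_le_of_monotoneOn hαβ hmmono).1).const_mul l
    -- Nothing is known of `ψ` on negative numbers; truncation at `0` makes it monotone on the whole
    -- line, hence measurable.
    have hmeas : Measurable fun x => ψ (max (deriv V x) 0) := by
      have : Monotone fun r : ℝ => ψ (max r 0) := fun r s hrs =>
        monotoneOn_of_convexOn hψ h0 hnn (mem_Ici.2 (le_max_right _ _))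
          (mem_Ici.2 (le_max_right _ _)) (max_le_max_right 0 hrs)
      exact this.measurable.comp (measurable_deriv V)
    have hcongr : (fun x => ψ (max (deriv V x) 0)) =ᵐ[volume.restrict (Ioo α β)]
        ψ ∘ deriv V := by
      filter_upwards [ae_restrict_mem measurableSet_Ioo] with x hx
      simp [max_eq_left (deriv_nonneg_of_monotoneOn_Icc hVmono hx)]
    refine Integrable.mono' hmint (hmeas.aestronglyMeasurable.congr hcongr) ?_
    filter_upwards [hψV, ae_restrict_mem measurableSet_Ioo] with x hx hxm
    rw [Function.comp_apply, Real.norm_of_nonneg (hnn _ (deriv_nonneg_of_monotoneOn_Icc hVmono hxm))]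
    exact hx
  -- `b` over `[s, t]` is at most the integral of `V'`; Jensen's inequality and the upper bound of
  -- `a` by `ψ` give this density.
  refine ⟨fun x => l * ψ (deriv V x), hψint.const_mul l, fun s t hs hst ht => ?_⟩
  have hts := sub_pos.2 hst
  have hsub : Ioo s t ⊆ Ioo α β := Ioo_subset_Ioo hs ht
  rw [intervalIntegral.integral_const_mul]
  refine (hle (t - s) hts _ _).2.trans (mul_le_mul_of_nonneg_left ?_ hl0.le)
  exact sub_mul_map_le_integral hψ h0 hnn hst
    (fun x hx => deriv_nonneg_of_monotoneOn_Icc hVmono (hsub hx)) (hVint.mono_set hsub)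
    (hψint.mono_set hsub) (hb.nonneg _ hts _ _)
    ((hV s t hs hst ht).trans (hVle s t hs hst ht))

end ActionSpace

/-! ### Existence of minimal curves -/

open ActionSpace in
theorem mainTheorem7 {X : Type*} [TopologicalSpace X] (a : ℝ → X → X → ℝ)
    (ha : ActionSpace.IsActionCost a)
    (hcomplete : ActionSpace.IsCompleteCost a)
    (hmid : ActionSpace.HasApproxMidpoints a)
    (hsuper : ActionSpace.IsUniformlySuperlinear a)
    (hcompact :
      (SeqCompactSpace X ∧ ActionSpace.IsSeqLowerSemicontinuous a) ∨
      (CompactSpace X ∧ ∀ τ, 0 < τ → LowerSemicontinuous (fun p : X × X => a τ p.1 p.2)))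
    (τ : ℝ) (hτ : 0 < τ) (u₀ u₁ : X) :
    (∀ Θ : ℝ → X, ActionSpace.IsAC a 0 τ Θ →
      ActionSpace.HasActionDensity a 0 τ Θ ∧
      IntervalIntegrable (ActionSpace.actionDensity a Θ) volume 0 τ) ∧
    (∃ ω : ℝ → X, ActionSpace.IsAC a 0 τ ω ∧ ω 0 = u₀ ∧ ω τ = u₁ ∧
      a τ u₀ u₁ = ∫ t in (0 : ℝ)..τ, ActionSpace.actionDensity a ω t) ∧
    IsLeast {I : ℝ | ∃ Θ : ℝ → X, ActionSpace.IsAC a 0 τ Θ ∧ Θ 0 = u₀ ∧ Θ τ = u₁ ∧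
      I = ∫ t in (0 : ℝ)..τ, ActionSpace.actionDensity a Θ t} (a τ u₀ u₁) := by
  have hlsc : HasLscClusters a := by
    rcases hcompact with ⟨_, h⟩ | ⟨_, h⟩
    · exact h.hasLscClusters
    · exact hasLscClusters_of_compactSpace h
  have hlower : ∀ Θ : ℝ → X, IsAC a 0 τ Θ → Θ 0 = u₀ → Θ τ = u₁ →
      a τ u₀ u₁ ≤ ∫ t in (0 : ℝ)..τ, actionDensity a Θ t := by
    rintro Θ hΘ rfl rfl
    simpa using (hΘ.hasActionDensity ha hτ).2.2.1
  obtain ⟨ω, m, hω0, hωτ, hm, hmle⟩ := exists_curve_isMajorant ha hcomplete hlsc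
    (fun ρ hρ u v => hlsc.exists_midpoint ha hmid hρ u v) (hsuper.exists_lt_of_le ha) hτ u₀ u₁
  have hAC : IsAC a 0 τ ω := hsuper.isAC ha hτ.le hm
  have heq : a τ u₀ u₁ = ∫ t in (0 : ℝ)..τ, actionDensity a ω t :=
    le_antisymm (hlower ω hAC hω0 hωτ) (((hAC.hasActionDensity ha hτ).2.2.2 m hm).trans hmle)
  refine ⟨fun Θ hΘ => ?_, ⟨ω, hAC, hω0, hωτ, heq⟩, ⟨ω, hAC, hω0, hωτ, heq⟩, ?_⟩
  · exact ⟨(hΘ.hasActionDensity ha hτ).1, (hΘ.hasActionDensity ha hτ).2.1⟩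
  · rintro _ ⟨Θ, hΘ, h0, h1, rfl⟩
    exact hlower Θ hΘ h0 h1
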